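/- Let $\nu_0,\nu_1,\nu_2\in i\mathbb{R}_{\geq 0}$ satisfy $\nu_0=\nu_1+\nu_2$, and put \[ T_0:=\max(2,|\nu_0|,|\nu_1|,|\nu_2|),\qquad \lambda:=1-3\nu_1^2-3\nu_1\nu_2-3\nu_2^2>0 . \] For $y_1,y_2>0$ let \[ \tilde W_{\nu_1,\nu_2}(y_1,y_2):=4\pi^{3/2}\prod_{j=0}^{2}\left|\Gamma\left(\tfrac12+\tfrac32\nu_j\right)\right|^{-1} y_1y_2\left(\frac{y_1}{y_2}\right)^{\frac{\nu_1-\nu_2}{2}}\int_0^\infty K_{\frac32\nu_0}\left(2\pi y_1\sqrt{1+u}\right)K_{\frac32\nu_0}\left(2\pi y_2\sqrt{1+u^{-1}}\right)u^{\frac34(\nu_1-\nu_2)}\,\frac{du}{u} \] be the normalized $\mathrm{GL}_3$ Jacquet--Whittaker function on the diagonal, where $K_\nu(x)=\int_0^\infty e^{-x\cosh t}\cosh(\nu t)\,dt$ $(x>0)$ is the $K$-Bessel function. Then $T_0\asymp\lambda^{1/2}$ with absolute implied constants, the integral over $u$ converges absolutely, and for every $A>0$ there is a constant $C_A>0$,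 depending only on $A$, such that for all such $\nu_0,\nu_1,\nu_2$ and all $y_1,y_2>0$, \[ \left|\tilde W_{\nu_1,\nu_2}(y_1,y_2)\right|\leq C_A\,(\log T_0)\sqrt{y_1y_2}\left(1+\frac{y_1}{T_0}\right)^{-A}\left(1+\frac{y_2}{T_0}\right)^{-A}. \] -/

import Mathlib

open MeasureTheory

/-- The integrand `exp (-x cosh t) * cosh (ν t)` of the modified Bessel function of the second
kind. -/
noncomputable def besselKIntegrand (ν : ℂ) (x t : ℝ) : ℂ :=
  (Real.exp (-x * Real.cosh t) : ℂ) * Complex.cosh (ν * t)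

/-- The `K`-Bessel function `K_ν(x) = ∫_0^∞ exp (-x cosh t) cosh (ν t) dt` for `ν ∈ ℂ` and
`x > 0`. -/
noncomputable def besselK (ν : ℂ) (x : ℝ) : ℂ :=
  ∫ t in Set.Ioi (0 : ℝ), besselKIntegrand ν x t

/-- The integral that defines `besselK ν x` converges absolutely for every `ν ∈ ℂ` and `x > 0`. -/
theorem integrableOn_besselKIntegrand (ν : ℂ) {x : ℝ} (hx : 0 < x) :
    IntegrableOn (besselKIntegrand ν x) (Set.Ioi 0) := by
  have hg : Integrable (fun t : ℝ => Real.exp (‖ν‖ ^ 2 / x) * Real.exp (-(x / 4) * t ^ 2)) :=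
    (integrable_exp_neg_mul_sq (by positivity)).const_mul _
  refine Integrable.mono' hg.integrableOn ?_ ?_
  · apply Continuous.aestronglyMeasurable
    unfold besselKIntegrand
    fun_prop
  · filter_upwards [ae_restrict_mem measurableSet_Ioi] with t ht
    have ht' : 0 < t := ht
    have h1 : ‖Complex.cosh (ν * t)‖ ≤ Real.exp (‖ν‖ * t) := by
      have hz : ‖ν * (t : ℂ)‖ = ‖ν‖ * t := by
        rw [norm_mul, Complex.norm_real, Real.norm_of_nonneg ht'.le]
      have ha := Complex.norm_exp_le_exp_norm (ν * t)
      have hb := Complex.norm_exp_le_exp_norm (-(ν * t))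
      rw [norm_neg] at hb
      rw [hz] at ha hb
      rw [Complex.cosh, norm_div]
      have hc := norm_add_le (Complex.exp (ν * t)) (Complex.exp (-(ν * t)))
      simp only [RCLike.norm_ofNat]
      linarith
    have h2 : 1 + t ^ 2 / 2 ≤ Real.cosh t := by
      have h3 : Real.cosh t = 1 + 2 * Real.sinh (t / 2) ^ 2 := by
        have h4 := Real.cosh_two_mul (t / 2)
        have h5 := Real.cosh_sq (t / 2)
        rw [show 2 * (t / 2) = t by ring] at h4
        linarith
      have h6 : t / 2 ≤ Real.sinh (t / 2) := Real.self_le_sinh_iff.2 (by positivity)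
      have h7 : (t / 2) ^ 2 ≤ Real.sinh (t / 2) ^ 2 := pow_le_pow_left₀ (by positivity) h6 2
      nlinarith
    have h8 : -x * Real.cosh t + ‖ν‖ * t ≤ ‖ν‖ ^ 2 / x + -(x / 4) * t ^ 2 := by
      have h9 : ‖ν‖ * t ≤ ‖ν‖ ^ 2 / x + x / 4 * t ^ 2 := by
        have h10 : ‖ν‖ ^ 2 / x + x / 4 * t ^ 2 - ‖ν‖ * t = (‖ν‖ - x * t / 2) ^ 2 / x := by
          field_simp
          ring
        have h11 : 0 ≤ (‖ν‖ - x * t / 2) ^ 2 / x := by positivity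
        linarith
      nlinarith
    calc ‖besselKIntegrand ν x t‖
        = Real.exp (-x * Real.cosh t) * ‖Complex.cosh (ν * t)‖ := by
          rw [besselKIntegrand, norm_mul, Complex.norm_real,
            Real.norm_of_nonneg (Real.exp_pos _).le]
      _ ≤ Real.exp (-x * Real.cosh t) * Real.exp (‖ν‖ * t) := by gcongr
      _ = Real.exp (-x * Real.cosh t + ‖ν‖ * t) := (Real.exp_add _ _).symm
      _ ≤ Real.exp (‖ν‖ ^ 2 / x + -(x / 4) * t ^ 2) := Real.exp_le_exp.2 h8
      _ = _ := Real.exp_add _ _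

/-- A triple of spectral parameters of tempered type, in the closed dominant chamber:
`ν₀, ν₁, ν₂ ∈ i ℝ_{≥ 0}` and `ν₀ = ν₁ + ν₂`. -/
structure IsTemperedSpectralParameter (ν₀ ν₁ ν₂ : ℂ) : Prop where
  re_zero : ν₀.re = 0
  re_one : ν₁.re = 0
  re_two : ν₂.re = 0
  im_zero_nonneg : 0 ≤ ν₀.im
  im_one_nonneg : 0 ≤ ν₁.im
  im_two_nonneg : 0 ≤ ν₂.im
  sum_eq : ν₀ = ν₁ + ν₂

/-- `T₀ = max (2, |ν₀|, |ν₁|, |ν₂|)`. -/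
noncomputable def spectralSize (ν₀ ν₁ ν₂ : ℂ) : ℝ :=
  max 2 (max ‖ν₀‖ (max ‖ν₁‖ ‖ν₂‖))

/-- The Laplace eigenvalue `λ = 1 - 3 ν₁² - 3 ν₁ ν₂ - 3 ν₂²` attached to the spectral
parameters. -/
noncomputable def laplaceEigenvalue (ν₁ ν₂ : ℂ) : ℂ :=
  1 - 3 * ν₁ ^ 2 - 3 * ν₁ * ν₂ - 3 * ν₂ ^ 2

/-- The integrand (with respect to `du` on `(0, ∞)`) of the Vinogradov--Takhtadzhyan integral;
here `ν₀ = ν₁ + ν₂`. -/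
noncomputable def whittakerIntegrand (ν₁ ν₂ : ℂ) (y₁ y₂ u : ℝ) : ℂ :=
  besselK (3 / 2 * (ν₁ + ν₂)) (2 * Real.pi * y₁ * √(1 + u)) *
    besselK (3 / 2 * (ν₁ + ν₂)) (2 * Real.pi * y₂ * √(1 + u⁻¹)) *
    (u : ℂ) ^ (3 / 4 * (ν₁ - ν₂)) / (u : ℂ)

/-- The normalized diagonal `GL₃` Jacquet--Whittaker function `W̃_{ν₁,ν₂}(y₁, y₂)`;
here `ν₀ = ν₁ + ν₂`. -/
noncomputable def normalizedWhittaker (ν₁ ν₂ : ℂ) (y₁ y₂ : ℝ) : ℂ :=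
  ((4 * Real.pi ^ (3 / 2 : ℝ) *
      (‖Complex.Gamma (1 / 2 + 3 / 2 * (ν₁ + ν₂))‖⁻¹ *
        ‖Complex.Gamma (1 / 2 + 3 / 2 * ν₁)‖⁻¹ *
        ‖Complex.Gamma (1 / 2 + 3 / 2 * ν₂)‖⁻¹) * (y₁ * y₂) : ℝ) : ℂ) *
    ((y₁ / y₂ : ℝ) : ℂ) ^ ((ν₁ - ν₂) / 2) *
    ∫ u in Set.Ioi (0 : ℝ), whittakerIntegrand ν₁ ν₂ y₁ y₂ u

/-!
The substitution `u = v²` and Cauchy–Schwarz bound the integral over `u` by the mean squares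
`∫ ‖K_ν(x √(1 + v²))‖² dv`, `ν = 3/2 ν₀`, for `x = 2πy₁` and `x = 2πy₂`. For imaginary `ν` the norm
can be dropped, since `K_ν` is real; writing `K_ν²` as a double integral over `(p, q)` with kernel
`exp (-2x √(1 + v²) cosh p cosh q)` and using polar coordinates in the plane
`(v, √(1 + v²) sinh q)`, the mean square becomes
`π / (2x) * ∫ exp (-2x cosh p + 2νp) / cosh p dp`.

The contour is then moved up to `Im p = arccos (1 / T₀)`, just below the pole at `iπ/2`. This gains
`exp (-2x / T₀)` from the first exponential and `exp (-π Im ν)`, up to a constant, from the second,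
while `∫ |cosh p|⁻¹` on the new line is `O(log T₀)`. By the reflection formula
`‖Γ(1/2 + ir)‖² = π / cosh (π r)`, the three Gamma factors cancel `exp (-π Im ν)` exactly because
`ν₀ = ν₁ + ν₂`.
-/

section

open Set Filter Topology
open scoped Real
open Complex (I)

theorem add_add_le_three_mul {a b c : ℝ} (ha : 1 ≤ a) (hb : 1 ≤ b) (hc : 1 ≤ c) :
    a + b + c ≤ 3 * (a * (b * c)) := by
  have hbc : 1 ≤ b * c := one_le_mul_of_one_le_of_one_le hb hc
  have hb' : b ≤ b * c := le_mul_of_one_le_right (by linarith) hc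
  have hc' : c ≤ b * c := le_mul_of_one_le_left (by linarith) hb
  linarith [le_mul_of_one_le_right (show 0 ≤ a by linarith) hbc,
    le_mul_of_one_le_left (show 0 ≤ b * c by linarith) ha]

theorem one_add_sq_div_two_le_cosh (t : ℝ) : 1 + t ^ 2 / 2 ≤ Real.cosh t := by
  have hcosh : Real.cosh t = 1 + 2 * Real.sinh (t / 2) ^ 2 := by
    have h := Real.cosh_two_mul (t / 2)
    rw [mul_div_cancel₀ t two_ne_zero, Real.cosh_sq] at h
    linarith
  have hsinh : (t / 2) ^ 2 ≤ Real.sinh (t / 2) ^ 2 := by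
    rw [sq_le_sq, Real.abs_sinh]
    exact Real.self_le_sinh_iff.2 (abs_nonneg _)
  linarith [div_pow t 2 2]

theorem sq_add_pow_four_div_four_le_sinh_sq (t : ℝ) : t ^ 2 + t ^ 4 / 4 ≤ Real.sinh t ^ 2 := by
  have h := pow_le_pow_left₀ (by positivity) (one_add_sq_div_two_le_cosh t) 2
  rw [Real.cosh_sq] at h
  linarith

theorem cosh_le_exp_abs (x : ℝ) : Real.cosh x ≤ Real.exp |x| := by
  have h : Real.exp (-|x|) ≤ Real.exp |x| := Real.exp_le_exp.2 (neg_le_self (abs_nonneg x))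
  rw [← Real.cosh_abs, Real.cosh_eq]
  linarith

theorem arcsin_le_pi_div_two_mul {x : ℝ} (hx₀ : 0 ≤ x) (hx₁ : x ≤ 1) :
    Real.arcsin x ≤ π / 2 * x := by
  have jordan := Real.mul_le_sin (Real.arcsin_nonneg.2 hx₀) (Real.arcsin_le_pi_div_two x)
  rw [Real.sin_arcsin (by linarith) hx₁, ← inv_div, inv_mul_le_iff₀ (by positivity)] at jordan
  exact jordan

theorem exp_neg_le_rpow_mul_one_add_rpow_neg {A s : ℝ} (hA : 0 ≤ A) (hs : 0 ≤ s) :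
    Real.exp (-s) ≤ (A + 1) ^ A * (1 + s) ^ (-A) := by
  have hbase : 1 + s ≤ (A + 1) * Real.exp (s / (A + 1)) := by
    have h := mul_le_mul_of_nonneg_left (Real.add_one_le_exp (s / (A + 1)))
      (show 0 ≤ A + 1 by positivity)
    rw [mul_add_one, mul_div_cancel₀ s (by positivity)] at h
    linarith
  have hpow : (1 + s) ^ A ≤ (A + 1) ^ A * Real.exp s :=
    calc (1 + s) ^ A ≤ ((A + 1) * Real.exp (s / (A + 1))) ^ A := by gcongr
      _ = (A + 1) ^ A * Real.exp (s / (A + 1) * A) := by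
        rw [Real.mul_rpow (by positivity) (by positivity), ← Real.exp_mul]
      _ ≤ (A + 1) ^ A * Real.exp s := by
        gcongr
        rw [div_mul_eq_mul_div, div_le_iff₀ (by positivity)]
        gcongr
        linarith
  rw [Real.exp_neg, Real.rpow_neg (by positivity), ← div_eq_mul_inv,
    le_div_iff₀ (by positivity), inv_mul_le_iff₀ (by positivity), mul_comm]
  exact hpow

section LogIntegral

variable {a b : ℝ}

theorem hasDerivAt_log_add_div_add {p : ℝ} (ha : 0 < a) (hb : 0 < b) (hab : a ≠ b) (hp : 0 ≤ p) :
    HasDerivAt (fun p => (b - a)⁻¹ * Real.log ((p + a) / (p + b))) ((p + a) * (p + b))⁻¹ p := by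
  have hpa : p + a ≠ 0 := by positivity
  have hpb : p + b ≠ 0 := by positivity
  have hba : b - a ≠ 0 := sub_ne_zero.2 hab.symm
  refine (((((hasDerivAt_id' p).add_const a).div ((hasDerivAt_id' p).add_const b) hpb).log
    (div_ne_zero hpa hpb)).const_mul (b - a)⁻¹).congr_deriv ?_
  simp only [Pi.div_apply]
  field_simp
  ring

theorem tendsto_log_add_div_add_atTop (a b : ℝ) :
    Tendsto (fun p => (b - a)⁻¹ * Real.log ((p + a) / (p + b))) atTop (𝓝 0) := by
  have hinv : Tendsto (fun p : ℝ => 1 - (b - a) * (p + b)⁻¹) atTop (𝓝 1) := by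
    simpa using ((tendsto_atTop_add_const_right _ b tendsto_id).inv_tendsto_atTop.const_mul
      (b - a)).const_sub 1
  have hratio : Tendsto (fun p : ℝ => (p + a) / (p + b)) atTop (𝓝 1) := by
    refine hinv.congr' ?_
    filter_upwards [eventually_gt_atTop (-b)] with p hp
    have : p + b ≠ 0 := by linarith
    field_simp
    ring
  simpa using (hratio.log one_ne_zero).const_mul (b - a)⁻¹

theorem integrableOn_Ioi_inv_add_mul_add (ha : 0 < a) (hb : 0 < b) (hab : a ≠ b) :
    IntegrableOn (fun p => ((p + a) * (p + b))⁻¹) (Ioi 0) :=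
  integrableOn_Ioi_deriv_of_nonneg' (fun _ hp => hasDerivAt_log_add_div_add ha hb hab hp)
    (fun p (hp : 0 < p) => by positivity) (tendsto_log_add_div_add_atTop a b)

theorem integral_Ioi_inv_add_mul_add (ha : 0 < a) (hb : 0 < b) (hab : a ≠ b) :
    ∫ p in Ioi 0, ((p + a) * (p + b))⁻¹ = (b - a)⁻¹ * Real.log (b / a) := by
  rw [integral_Ioi_of_hasDerivAt_of_nonneg'
    (fun _ hp => hasDerivAt_log_add_div_add ha hb hab hp)
    (fun p (hp : 0 < p) => by positivity) (tendsto_log_add_div_add_atTop a b),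
    zero_add, zero_add, zero_sub, ← mul_neg, ← Real.log_inv, inv_div]

end LogIntegral

theorem inv_sqrt_sinh_sq_add_sq_le_inv_one_add_sq {ε : ℝ} (hε : ε ≠ 0) (p : ℝ) :
    (√(Real.sinh p ^ 2 + ε ^ 2))⁻¹ ≤ √(4 + (ε ^ 2)⁻¹) * (1 + p ^ 2)⁻¹ := by
  rw [← div_eq_mul_inv, inv_le_comm₀ (by positivity) (by positivity), inv_div]
  rw [div_le_iff₀ (by positivity), ← Real.sqrt_mul (by positivity)]
  refine Real.le_sqrt_of_sq_le ?_
  have hε2 : 0 < ε ^ 2 := by positivity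
  have hinv : ε ^ 2 * (ε ^ 2)⁻¹ = 1 := mul_inv_cancel₀ hε2.ne'
  have hlow : 0 ≤ (p ^ 2 + p ^ 4 / 4) * (ε ^ 2)⁻¹ := by positivity
  nlinarith [sq_add_pow_four_div_four_le_sinh_sq p, mul_le_mul_of_nonneg_right
    (sq_add_pow_four_div_four_le_sinh_sq p) (inv_pos.2 hε2).le]

theorem inv_sqrt_sinh_sq_add_sq_le {ε p : ℝ} (hε : 0 < ε) (hε₁ : ε ≤ 1) (hp : 0 ≤ p) :
    (√(Real.sinh p ^ 2 + ε ^ 2))⁻¹ ≤ 4 * ((p + ε) * (p + 1))⁻¹ := by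
  have hlower : (p + ε) * (p + 1) / 4 ≤ √(Real.sinh p ^ 2 + ε ^ 2) := by
    refine Real.le_sqrt_of_sq_le ?_
    have hεp : ε ^ 2 * p ^ 2 ≤ p ^ 2 :=
      mul_le_of_le_one_left (sq_nonneg p) (pow_le_one₀ hε.le hε₁)
    have hprod := mul_le_mul (add_sq_le (a := p) (b := ε)) (add_sq_le (a := p) (b := 1))
      (by positivity) (by positivity)
    nlinarith [sq_add_pow_four_div_four_le_sinh_sq p]
  rw [← div_eq_mul_inv, ← inv_div]
  exact inv_anti₀ (by positivity) hlower

theorem integrable_inv_sqrt_sinh_sq_add_sq {ε : ℝ} (hε : ε ≠ 0) :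
    Integrable fun p : ℝ => (√(Real.sinh p ^ 2 + ε ^ 2))⁻¹ := by
  have hcont : Continuous fun p : ℝ => (√(Real.sinh p ^ 2 + ε ^ 2))⁻¹ :=
    Continuous.inv₀ (by fun_prop) fun p => by positivity
  refine (integrable_inv_one_add_sq.const_mul √(4 + (ε ^ 2)⁻¹)).mono' hcont.aestronglyMeasurable
    (ae_of_all _ fun p => ?_)
  rw [Real.norm_of_nonneg (by positivity)]
  exact inv_sqrt_sinh_sq_add_sq_le_inv_one_add_sq hε p

theorem tendsto_inv_sqrt_sinh_sq_add_sq_cocompact {ε : ℝ} (hε : ε ≠ 0) :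
    Tendsto (fun p : ℝ => (√(Real.sinh p ^ 2 + ε ^ 2))⁻¹) (cocompact ℝ) (𝓝 0) := by
  have hsq : Tendsto (fun p : ℝ => 1 + p ^ 2) (cocompact ℝ) atTop := by
    simpa using tendsto_atTop_add_const_left _ 1
      ((tendsto_pow_atTop two_ne_zero).comp (tendsto_norm_cocompact_atTop (E := ℝ)))
  refine squeeze_zero (fun p => by positivity) (inv_sqrt_sinh_sq_add_sq_le_inv_one_add_sq hε) ?_
  simpa using hsq.inv_tendsto_atTop.const_mul √(4 + (ε ^ 2)⁻¹)

theorem integral_inv_sqrt_sinh_sq_add_sq_le {ε : ℝ} (hε : 0 < ε) (hε' : ε ≤ 1 / 2) :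
    ∫ p : ℝ, (√(Real.sinh p ^ 2 + ε ^ 2))⁻¹ ≤ 16 * Real.log ε⁻¹ := by
  have heven : ∫ p : ℝ, (√(Real.sinh p ^ 2 + ε ^ 2))⁻¹ =
      2 * ∫ p in Ioi 0, (√(Real.sinh p ^ 2 + ε ^ 2))⁻¹ := by
    rw [← integral_comp_abs (f := fun p => (√(Real.sinh p ^ 2 + ε ^ 2))⁻¹)]
    simp only [← Real.abs_sinh]
    simp only [sq_abs]
  have hmajor := integrableOn_Ioi_inv_add_mul_add hε one_pos (by linarith)
  have hlog : 0 ≤ Real.log ε⁻¹ := Real.log_nonneg ((one_le_inv₀ hε).2 (by linarith))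
  have hfactor : (1 - ε)⁻¹ ≤ 2 := by
    rw [inv_le_comm₀ (by linarith) two_pos]
    linarith
  calc ∫ p : ℝ, (√(Real.sinh p ^ 2 + ε ^ 2))⁻¹
      ≤ 2 * ∫ p in Ioi 0, 4 * ((p + ε) * (p + 1))⁻¹ := by
        rw [heven]
        refine mul_le_mul_of_nonneg_left ?_ zero_le_two
        exact setIntegral_mono_on (integrable_inv_sqrt_sinh_sq_add_sq hε.ne').integrableOn
          (hmajor.const_mul 4) measurableSet_Ioi fun p hp =>
            inv_sqrt_sinh_sq_add_sq_le hε (by linarith) (le_of_lt hp)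
    _ = 8 * ((1 - ε)⁻¹ * Real.log ε⁻¹) := by
        rw [integral_const_mul, integral_Ioi_inv_add_mul_add hε one_pos (by linarith), one_div]
        ring
    _ ≤ 8 * (2 * Real.log ε⁻¹) := by gcongr
    _ = 16 * Real.log ε⁻¹ := by ring

theorem tendsto_intervalIntegral_add_mul_I_zero {E : Type*} [NormedAddCommGroup E]
    [NormedSpace ℝ E] {f : ℂ → E} {φ : ℝ} (hφ : 0 ≤ φ) {l : Filter ℝ} {g : ℝ → ℝ}
    (hg : Tendsto g l (𝓝 0)) (hfg : ∀ᶠ x : ℝ in l, ∀ y ∈ Icc 0 φ, ‖f (x + y * I)‖ ≤ g x) :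
    Tendsto (fun x : ℝ => ∫ y in 0..φ, f (x + y * I)) l (𝓝 0) := by
  refine squeeze_zero_norm' (a := fun x => g x * |φ - 0|) ?_ (by simpa using hg.mul_const _)
  filter_upwards [hfg] with x hx
  refine intervalIntegral.norm_integral_le_of_norm_le_const fun y hy => hx y ?_
  rw [uIoc_of_le hφ] at hy
  exact Ioc_subset_Icc_self hy

theorem intervalIntegral_sub_intervalIntegral_add_mul_I {E : Type*} [NormedAddCommGroup E]
    [NormedSpace ℂ E] [CompleteSpace E] {f : ℂ → E} {φ : ℝ} (hφ : 0 ≤ φ)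
    (hf : ∀ z : ℂ, z.im ∈ Icc 0 φ → DifferentiableAt ℂ f z) (a b : ℝ) :
    (∫ x in a..b, f x) - ∫ x in a..b, f (x + φ * I) =
      I • (∫ y in 0..φ, f (a + y * I)) - I • ∫ y in 0..φ, f (b + y * I) := by
  have hboundary := Complex.integral_boundary_rect_eq_zero_of_differentiableOn f a (b + φ * I)
    fun z hz => by
      refine (hf z ?_).differentiableWithinAt
      simpa [uIcc_of_le hφ] using hz.2
  simp only [Complex.ofReal_re, Complex.ofReal_im, Complex.add_re, Complex.add_im,
    Complex.re_ofReal_mul, Complex.im_ofReal_mul, Complex.I_re, Complex.I_im, mul_zero, mul_one,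
    add_zero, zero_add, Complex.ofReal_zero, zero_mul] at hboundary
  rw [← sub_eq_zero, ← hboundary]
  abel

theorem integral_eq_integral_add_mul_I {E : Type*} [NormedAddCommGroup E] [NormedSpace ℂ E]
    [CompleteSpace E] {f : ℂ → E} {φ : ℝ} (hφ : 0 ≤ φ)
    (hf : ∀ z : ℂ, z.im ∈ Icc 0 φ → DifferentiableAt ℂ f z) {g : ℝ → ℝ} (hg : Integrable g)
    (hg₀ : Tendsto g (cocompact ℝ) (𝓝 0))
    (hfg : ∀ x : ℝ, ∀ y ∈ Icc 0 φ, ‖f (x + y * I)‖ ≤ g x) :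
    ∫ x : ℝ, f x = ∫ x : ℝ, f (x + φ * I) := by
  have hline {y : ℝ} (hy : y ∈ Icc 0 φ) : Integrable fun x : ℝ => f (x + y * I) := by
    have hcont : Continuous fun x : ℝ => f (x + y * I) := continuous_iff_continuousAt.2 fun x =>
      ContinuousAt.comp (f := fun x : ℝ => (x : ℂ) + y * I)
        (hf _ (by simpa using hy)).continuousAt (by fun_prop)
    exact hg.mono' hcont.aestronglyMeasurable (ae_of_all _ fun x => hfg x y hy)
  have hbottom : Integrable fun x : ℝ => f x := by simpa using hline (left_mem_Icc.2 hφ)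
  have hsides : Tendsto (fun R : ℝ => I • (∫ y in 0..φ, f ((-R : ℝ) + y * I)) -
      I • ∫ y in 0..φ, f (R + y * I)) atTop (𝓝 0) := by
    have hvertical {l : Filter ℝ} (hl : l ≤ cocompact ℝ) :
        Tendsto (fun x : ℝ => I • ∫ y in 0..φ, f (x + y * I)) l (𝓝 0) := by
      simpa only [smul_zero] using (tendsto_intervalIntegral_add_mul_I_zero hφ (hg₀.mono_left hl)
        (Eventually.of_forall hfg)).const_smul I
    simpa only [sub_zero, Function.comp_def] using
      ((hvertical atBot_le_cocompact).comp tendsto_neg_atTop_atBot).sub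
        (hvertical atTop_le_cocompact)
  have hlines := (intervalIntegral_tendsto_integral hbottom tendsto_neg_atTop_atBot tendsto_id).sub
    (intervalIntegral_tendsto_integral (hline (right_mem_Icc.2 hφ)) tendsto_neg_atTop_atBot
      tendsto_id)
  exact sub_eq_zero.1 (tendsto_nhds_unique hlines (hsides.congr fun R =>
    (intervalIntegral_sub_intervalIntegral_add_mul_I hφ hf (-R) R).symm))

theorem re_cosh_add_mul_I (p y : ℝ) : (Complex.cosh (p + y * I)).re = Real.cosh p * Real.cos y := by
  rw [Complex.cosh_add, Complex.cosh_mul_I, Complex.sinh_mul_I, ← Complex.ofReal_cosh,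
    ← Complex.ofReal_sinh, ← Complex.ofReal_cos, ← Complex.ofReal_sin, ← mul_assoc,
    ← Complex.ofReal_mul, ← Complex.ofReal_mul, Complex.add_re, Complex.ofReal_re,
    Complex.re_ofReal_mul, Complex.I_re, mul_zero, add_zero]

theorem im_cosh_add_mul_I (p y : ℝ) : (Complex.cosh (p + y * I)).im = Real.sinh p * Real.sin y := by
  rw [Complex.cosh_add, Complex.cosh_mul_I, Complex.sinh_mul_I, ← Complex.ofReal_cosh,
    ← Complex.ofReal_sinh, ← Complex.ofReal_cos, ← Complex.ofReal_sin, ← mul_assoc,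
    ← Complex.ofReal_mul, ← Complex.ofReal_mul, Complex.add_im, Complex.ofReal_im,
    Complex.im_ofReal_mul, Complex.I_im, mul_one, zero_add]

theorem norm_cosh_add_mul_I (p y : ℝ) :
    ‖Complex.cosh (p + y * I)‖ = √(Real.sinh p ^ 2 + Real.cos y ^ 2) := by
  rw [Complex.norm_eq_sqrt_sq_add_sq, re_cosh_add_mul_I, im_cosh_add_mul_I, mul_pow, mul_pow,
    Real.cosh_sq, Real.sin_sq]
  ring_nf

/-- The integrand `exp (-x cosh z + ν z) / cosh z` to which polar coordinates reduce the mean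
square of a `K`-Bessel function. -/
noncomputable def sechKernel (x : ℝ) (ν z : ℂ) : ℂ :=
  Complex.exp (-x * Complex.cosh z + ν * z) / Complex.cosh z

section SechKernel

variable {x y p : ℝ} {ν : ℂ}

theorem differentiableAt_sechKernel {z : ℂ} (hz : Complex.cosh z ≠ 0) :
    DifferentiableAt ℂ (sechKernel x ν) z := by
  have hcosh : DifferentiableAt ℂ Complex.cosh z := Complex.differentiable_cosh z
  exact DifferentiableAt.div (by fun_prop) hcosh hz

theorem norm_sechKernel_add_mul_I_le (hν : ν.re = 0) (hx : 0 ≤ x) (hy : 0 ≤ Real.cos y) :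
    ‖sechKernel x ν (p + y * I)‖ ≤
      Real.exp (-x * Real.cos y - ν.im * y) * (√(Real.sinh p ^ 2 + Real.cos y ^ 2))⁻¹ := by
  rw [sechKernel, norm_div, Complex.norm_exp, norm_cosh_add_mul_I, div_eq_mul_inv, Complex.add_re,
    ← Complex.ofReal_neg, Complex.re_ofReal_mul, re_cosh_add_mul_I, Complex.mul_re, hν]
  simp only [Complex.add_im, Complex.ofReal_im, Complex.im_ofReal_mul, Complex.I_im, mul_one,
    zero_add, zero_mul, zero_sub, ← sub_eq_add_neg]
  gcongr ?_ * _
  refine Real.exp_le_exp.2 (sub_le_sub_right ?_ _)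
  exact mul_le_mul_of_nonpos_left (le_mul_of_one_le_left hy (Real.one_le_cosh p))
    (neg_nonpos.2 hx)

theorem norm_integral_sechKernel_le (hν : ν.re = 0) (hx : 0 ≤ x) {φ : ℝ} (hφ : 0 ≤ φ)
    (hφ' : φ < π / 2) :
    ‖∫ p : ℝ, sechKernel x ν p‖ ≤ Real.exp (-x * Real.cos φ - ν.im * φ) *
      ∫ p : ℝ, (√(Real.sinh p ^ 2 + Real.cos φ ^ 2))⁻¹ := by
  have hcos_pos {y : ℝ} (hy : y ∈ Icc 0 φ) : 0 < Real.cos y :=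
    Real.cos_pos_of_mem_Ioo ⟨by linarith [hy.1, Real.pi_pos], hy.2.trans_lt hφ'⟩
  have hcosφ : Real.cos φ ≠ 0 := (hcos_pos (right_mem_Icc.2 hφ)).ne'
  have hint := integrable_inv_sqrt_sinh_sq_add_sq hcosφ
  have hdiff (z : ℂ) (hz : z.im ∈ Icc 0 φ) : DifferentiableAt ℂ (sechKernel x ν) z := by
    refine differentiableAt_sechKernel fun hzero => ?_
    have hre := re_cosh_add_mul_I z.re z.im
    rw [Complex.re_add_im, hzero, Complex.zero_re] at hre
    exact (mul_pos (Real.cosh_pos z.re) (hcos_pos hz)).ne hre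
  have hmajor (p y : ℝ) (hy : y ∈ Icc 0 φ) : ‖sechKernel x ν (p + y * I)‖ ≤
      Real.exp (|ν.im| * φ) * (√(Real.sinh p ^ 2 + Real.cos φ ^ 2))⁻¹ := by
    have hcos : Real.cos φ ≤ Real.cos y :=
      Real.cos_le_cos_of_nonneg_of_le_pi hy.1 (by linarith [Real.pi_pos]) hy.2
    have hexp : -x * Real.cos y - ν.im * y ≤ |ν.im| * φ := by
      have hxcos := mul_nonneg hx (hcos_pos hy).le
      have him : -ν.im * y ≤ |ν.im| * φ :=
        mul_le_mul (neg_le_abs _) hy.2 hy.1 (abs_nonneg _)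
      linarith
    refine (norm_sechKernel_add_mul_I_le hν hx (hcos_pos hy).le).trans ?_
    have := hcos_pos (right_mem_Icc.2 hφ)
    gcongr
  rw [integral_eq_integral_add_mul_I hφ hdiff (hint.const_mul _)
    (by simpa only [mul_zero] using (tendsto_inv_sqrt_sinh_sq_add_sq_cocompact hcosφ).const_mul _)
    hmajor, ← integral_const_mul]
  exact norm_integral_le_of_norm_le (hint.const_mul _) (ae_of_all _ fun p =>
    norm_sechKernel_add_mul_I_le hν hx (hcos_pos (right_mem_Icc.2 hφ)).le)

end SechKernel

section PolarCoordinates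

variable {E : Type*} [NormedAddCommGroup E] [NormedSpace ℝ E]

theorem integral_comp_mul_cosh {a : ℝ} (ha : 0 < a) (f : ℝ → E) :
    ∫ q : ℝ, f (a * Real.cosh q) = ∫ X : ℝ, (√(a ^ 2 + X ^ 2))⁻¹ • f √(a ^ 2 + X ^ 2) := by
  have hrange : (fun q => a * Real.sinh q) '' univ = univ :=
    image_univ_of_surjective ((mul_left_surjective₀ ha.ne').comp Real.sinh_surjective)
  have hsubst := integral_image_eq_integral_abs_deriv_smul MeasurableSet.univ
    (fun q _ => ((Real.hasDerivAt_sinh q).const_mul a).hasDerivWithinAt)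
    ((mul_right_injective₀ ha.ne').comp Real.sinh_injective).injOn
    (fun X => (√(a ^ 2 + X ^ 2))⁻¹ • f √(a ^ 2 + X ^ 2))
  rw [hrange, setIntegral_univ, setIntegral_univ] at hsubst
  rw [hsubst]
  refine integral_congr_ae (ae_of_all _ fun q => ?_)
  have hpos : 0 < a * Real.cosh q := mul_pos ha (Real.cosh_pos q)
  have hsqrt : √(a ^ 2 + (a * Real.sinh q) ^ 2) = a * Real.cosh q := by
    rw [Real.sqrt_eq_iff_mul_self_eq (by positivity) hpos.le, mul_mul_mul_comm, ← sq, ← sq,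
      Real.cosh_sq]
    ring
  simp only [hsqrt, abs_of_pos hpos, smul_smul, mul_inv_cancel₀ hpos.ne', one_smul]

theorem integral_comp_sq_add_sq (f : ℝ → E) :
    ∫ z : ℝ × ℝ, f (z.1 ^ 2 + z.2 ^ 2) = (2 * π) • ∫ ρ in Ioi 0, ρ • f (ρ ^ 2) := by
  have hnorm := integral_fun_norm_addHaar (volume : Measure ℂ) fun ρ => f (ρ ^ 2)
  simp only [Complex.finrank_real_complex, measureReal_def, Complex.volume_ball] at hnorm
  have hsq (z : ℂ) : z.re ^ 2 + z.im ^ 2 = ‖z‖ ^ 2 := by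
    rw [Complex.sq_norm, Complex.normSq_apply, sq, sq]
  rw [← Complex.volume_preserving_equiv_real_prod.integral_comp
    Complex.measurableEquivRealProd.measurableEmbedding]
  simp only [Complex.measurableEquivRealProd_apply, hsq, hnorm]
  simp [mul_smul, two_smul]

end PolarCoordinates

section BesselMeanSquare

variable {c : ℝ}

theorem integral_Ioi_mul_exp_neg_mul_sqrt (hc : 0 < c) :
    ∫ ρ in Ioi 0, ρ * ((√(1 + ρ ^ 2))⁻¹ * Real.exp (-c * √(1 + ρ ^ 2))) = Real.exp (-c) / c := by
  have hderiv (ρ : ℝ) : HasDerivAt (fun ρ => -(c⁻¹ * Real.exp (-c * √(1 + ρ ^ 2))))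
      (ρ * ((√(1 + ρ ^ 2))⁻¹ * Real.exp (-c * √(1 + ρ ^ 2)))) ρ := by
    have hsq : HasDerivAt (fun ρ : ℝ => 1 + ρ ^ 2) (2 * ρ) ρ := by
      simpa using (hasDerivAt_pow 2 ρ).const_add 1
    refine (((hsq.sqrt (by positivity)).const_mul (-c)).exp.const_mul c⁻¹).neg.congr_deriv ?_
    field_simp
  have hlim : Tendsto (fun ρ => -(c⁻¹ * Real.exp (-c * √(1 + ρ ^ 2)))) atTop (𝓝 0) := by
    have hsqrt : Tendsto (fun ρ : ℝ => √(1 + ρ ^ 2)) atTop atTop :=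
      tendsto_atTop_mono (fun ρ => Real.le_sqrt_of_sq_le (by simp)) tendsto_id
    have hexp := Real.tendsto_exp_atBot.comp (hsqrt.const_mul_atTop_of_neg (neg_lt_zero.2 hc))
    simpa using (hexp.const_mul c⁻¹).neg
  rw [integral_Ioi_of_hasDerivAt_of_nonneg' (fun ρ _ => hderiv ρ)
    (fun ρ (hρ : 0 < ρ) => by positivity) hlim]
  simp [div_eq_inv_mul]

theorem integrable_exp_neg_mul_sqrt_one_add_sq (hc : 0 < c) :
    Integrable fun v : ℝ => Real.exp (-c * √(1 + v ^ 2)) := by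
  refine (integrable_inv_one_add_sq.const_mul (2 / c ^ 2)).mono' (by fun_prop)
    (ae_of_all _ fun v => ?_)
  have hquadratic : c ^ 2 / 2 * (1 + v ^ 2) ≤ Real.exp (c * √(1 + v ^ 2)) := by
    have h := Real.quadratic_le_exp_of_nonneg (show 0 ≤ c * √(1 + v ^ 2) by positivity)
    rw [mul_pow, Real.sq_sqrt (by positivity)] at h
    have : 0 ≤ c * √(1 + v ^ 2) := by positivity
    linarith
  rw [Real.norm_of_nonneg (Real.exp_pos _).le, neg_mul, Real.exp_neg, ← inv_div, ← mul_inv]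
  exact inv_anti₀ (by positivity) hquadratic

theorem integrable_inv_sqrt_mul_exp_neg_mul_sqrt (hc : 0 < c) :
    Integrable fun z : ℝ × ℝ => (√(1 + (z.1 ^ 2 + z.2 ^ 2)))⁻¹ *
      Real.exp (-c * √(1 + (z.1 ^ 2 + z.2 ^ 2))) := by
  have hmajor := (integrable_exp_neg_mul_sqrt_one_add_sq (half_pos hc)).mul_prod
    (integrable_exp_neg_mul_sqrt_one_add_sq (half_pos hc))
  refine hmajor.mono' (Continuous.aestronglyMeasurable ?_) (ae_of_all _ fun z => ?_)
  · exact Continuous.mul (Continuous.inv₀ (by fun_prop) fun z => by positivity) (by fun_prop)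
  · have hfst : √(1 + z.1 ^ 2) ≤ √(1 + (z.1 ^ 2 + z.2 ^ 2)) :=
      Real.sqrt_le_sqrt (by linarith [sq_nonneg z.2])
    have hsnd : √(1 + z.2 ^ 2) ≤ √(1 + (z.1 ^ 2 + z.2 ^ 2)) :=
      Real.sqrt_le_sqrt (by linarith [sq_nonneg z.1])
    have hone : 1 ≤ √(1 + (z.1 ^ 2 + z.2 ^ 2)) := by
      rw [Real.one_le_sqrt]
      linarith [sq_nonneg z.1, sq_nonneg z.2]
    rw [Real.norm_of_nonneg (by positivity), ← Real.exp_add]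
    refine (mul_le_of_le_one_left (Real.exp_pos _).le (inv_le_one_of_one_le₀ hone)).trans ?_
    rw [Real.exp_le_exp]
    linarith [mul_le_mul_of_nonneg_left hfst hc.le, mul_le_mul_of_nonneg_left hsnd hc.le]

theorem integral_integral_exp_neg_mul_sqrt_mul_cosh (hc : 0 < c) :
    ∫ v : ℝ, ∫ q : ℝ, Real.exp (-c * (√(1 + v ^ 2) * Real.cosh q)) =
      2 * π * (Real.exp (-c) / c) := by
  have hcosh (v : ℝ) := integral_comp_mul_cosh (show 0 < √(1 + v ^ 2) by positivity)
    fun s => Real.exp (-c * s)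
  have hpolar := integral_comp_sq_add_sq fun s => (√(1 + s))⁻¹ * Real.exp (-c * √(1 + s))
  rw [Measure.volume_eq_prod, integral_prod _ (integrable_inv_sqrt_mul_exp_neg_mul_sqrt hc)]
    at hpolar
  simp only [hcosh, Real.sq_sqrt (add_nonneg zero_le_one (sq_nonneg _)), add_assoc, smul_eq_mul]
  simpa only [smul_eq_mul, integral_Ioi_mul_exp_neg_mul_sqrt hc] using hpolar

theorem integrable_exp_neg_mul_cosh_add_mul (hc : 0 < c) (b : ℝ) :
    Integrable fun t : ℝ => Real.exp (-c * Real.cosh t + b * t) := by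
  refine ((integrable_exp_neg_mul_sq (show 0 < c / 4 by positivity)).const_mul
    (Real.exp (b ^ 2 / c))).mono' (by fun_prop) (ae_of_all _ fun t => ?_)
  rw [Real.norm_of_nonneg (Real.exp_pos _).le, ← Real.exp_add, Real.exp_le_exp]
  have hsquare : b ^ 2 / c + c / 4 * t ^ 2 - b * t = (b - c * t / 2) ^ 2 / c := by
    field_simp
    ring
  have hcosh := mul_le_mul_of_nonneg_left (one_add_sq_div_two_le_cosh t) hc.le
  linarith [show 0 ≤ (b - c * t / 2) ^ 2 / c by positivity]

theorem integrable_cexp_neg_mul_cosh_add_mul (hc : 0 < c) (ν : ℂ) :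
    Integrable fun t : ℝ => Complex.exp (-c * Real.cosh t + ν * t) := by
  refine (integrable_exp_neg_mul_cosh_add_mul hc ν.re).mono' (by fun_prop)
    (ae_of_all _ fun t => le_of_eq ?_)
  rw [Complex.norm_exp, Complex.add_re, Complex.re_mul_ofReal, Complex.re_mul_ofReal,
    Complex.neg_re, Complex.ofReal_re]

theorem besselK_eq_half_integral (ν : ℂ) {x : ℝ} (hx : 0 < x) :
    besselK ν x = 1 / 2 * ∫ t : ℝ, Complex.exp (-x * Real.cosh t + ν * t) := by
  have hint := integrable_cexp_neg_mul_cosh_add_mul hx ν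
  have hint_neg := integrable_cexp_neg_mul_cosh_add_mul hx (-ν)
  have hreflect : ∫ t in Iic (0 : ℝ), Complex.exp (-x * Real.cosh t + ν * t) =
      ∫ t in Ioi (0 : ℝ), Complex.exp (-x * Real.cosh t + -ν * t) := by
    rw [← neg_zero, ← integral_comp_neg_Ioi, neg_zero]
    simp only [Real.cosh_neg, Complex.ofReal_neg, mul_neg, neg_mul]
  rw [← integral_add_compl measurableSet_Iic hint, compl_Iic, hreflect,
    ← integral_add hint_neg.integrableOn hint.integrableOn, ← integral_const_mul, besselK]
  refine integral_congr_ae (ae_of_all _ fun t => ?_)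
  simp only [besselKIntegrand, Complex.cosh, Complex.ofReal_exp, Complex.exp_add,
    Complex.ofReal_mul, Complex.ofReal_neg, neg_mul]
  ring

-- The product of two copies of the integral is the integral of a convolution square, which at
-- `2 * p` collapses because `cosh (p + q) + cosh (p - q) = 2 * cosh p * cosh q`.
theorem besselK_sq (ν : ℂ) {x : ℝ} (hx : 0 < x) :
    besselK ν x ^ 2 = 1 / 2 * ∫ p : ℝ, ∫ q : ℝ, Complex.exp (2 * ν * p) *
      (Real.exp (-2 * x * (Real.cosh p * Real.cosh q)) : ℝ) := by
  have hint := integrable_cexp_neg_mul_cosh_add_mul hx ν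
  set f : ℝ → ℂ := fun t => Complex.exp (-x * Real.cosh t + ν * t) with hf
  set mul := ContinuousLinearMap.mul ℂ ℂ
  have hscale := Measure.integral_comp_mul_left (fun s => convolution f f mul volume s) 2
  rw [integral_convolution mul hint hint] at hscale
  have hconv (p : ℝ) : convolution f f mul volume (2 * p) = ∫ q : ℝ, Complex.exp (2 * ν * p) *
      (Real.exp (-2 * x * (Real.cosh p * Real.cosh q)) : ℝ) := by
    rw [convolution, ← integral_add_left_eq_self _ p]
    refine integral_congr_ae (ae_of_all _ fun q => ?_)
    simp only [mul, ContinuousLinearMap.mul_apply', hf, Complex.ofReal_exp, ← Complex.exp_add]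
    rw [show 2 * p - (p + q) = p - q by ring, Real.cosh_add, Real.cosh_sub]
    push_cast
    ring_nf
  have hhalf : besselK ν x = 1 / 2 * ∫ t : ℝ, f t := besselK_eq_half_integral ν hx
  simp only [hconv] at hscale
  rw [hscale, hhalf, ContinuousLinearMap.mul_apply', Complex.real_smul,
    abs_of_pos (by positivity)]
  push_cast
  ring

theorem integrable_cexp_mul_exp_neg_mul_sqrt_mul_cosh_mul_cosh (ν : ℂ) (hc : 0 < c) :
    Integrable fun z : (ℝ × ℝ) × ℝ => Complex.exp (ν * z.1.2) *
      (Real.exp (-c * √(1 + z.1.1 ^ 2) * (Real.cosh z.1.2 * Real.cosh z.2)) : ℝ) := by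
  have hc' : 0 < c / 3 := by positivity
  have hmajor := ((integrable_exp_neg_mul_sqrt_one_add_sq hc').mul_prod
    (integrable_exp_neg_mul_cosh_add_mul hc' ν.re)).mul_prod
    (integrable_exp_neg_mul_cosh_add_mul hc' 0)
  refine hmajor.mono' (Continuous.aestronglyMeasurable (by fun_prop)) (ae_of_all _ fun z => ?_)
  rw [norm_mul, Complex.norm_exp, Complex.re_mul_ofReal, Complex.norm_real,
    Real.norm_of_nonneg (Real.exp_pos _).le, ← Real.exp_add, ← Real.exp_add, ← Real.exp_add,
    Real.exp_le_exp]
  have hsqrt : 1 ≤ √(1 + z.1.1 ^ 2) := Real.one_le_sqrt.2 (by linarith [sq_nonneg z.1.1])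
  have hsum := mul_le_mul_of_nonneg_left (add_add_le_three_mul hsqrt (Real.one_le_cosh z.1.2)
    (Real.one_le_cosh z.2)) hc'.le
  linarith

theorem integral_integral_cexp_mul_exp_neg_mul_sqrt_mul_cosh_mul_cosh (ν : ℂ) {p x : ℝ}
    (hx : 0 < x) :
    ∫ v : ℝ, ∫ q : ℝ, Complex.exp (ν * p) *
      (Real.exp (-x * √(1 + v ^ 2) * (Real.cosh p * Real.cosh q)) : ℝ) =
      2 * π / x * sechKernel x ν p := by
  have hreal := integral_integral_exp_neg_mul_sqrt_mul_cosh (mul_pos hx (Real.cosh_pos p))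
  have hregroup (v q : ℝ) : -x * √(1 + v ^ 2) * (Real.cosh p * Real.cosh q) =
      -(x * Real.cosh p) * (√(1 + v ^ 2) * Real.cosh q) := by ring
  simp only [hregroup, integral_const_mul, integral_complex_ofReal, hreal, sechKernel,
    Complex.exp_add]
  push_cast
  rw [neg_mul]
  ring

theorem integrable_besselK_sq (ν : ℂ) {x : ℝ} (hx : 0 < x) :
    Integrable fun v : ℝ => besselK ν (x * √(1 + v ^ 2)) ^ 2 := by
  have hint := integrable_cexp_mul_exp_neg_mul_sqrt_mul_cosh_mul_cosh (2 * ν)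
    (mul_pos two_pos hx)
  have hsq (v : ℝ) := besselK_sq ν (x := x * √(1 + v ^ 2)) (by positivity)
  simpa only [hsq, neg_mul, mul_assoc] using
    hint.integral_prod_left.integral_prod_left.const_mul (1 / 2)

theorem integral_besselK_sq (ν : ℂ) {x : ℝ} (hx : 0 < x) :
    ∫ v : ℝ, besselK ν (x * √(1 + v ^ 2)) ^ 2 =
      π / (2 * x) * ∫ p : ℝ, sechKernel (2 * x) (2 * ν) p := by
  have hint := integrable_cexp_mul_exp_neg_mul_sqrt_mul_cosh_mul_cosh (2 * ν)
    (mul_pos two_pos hx)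
  calc ∫ v : ℝ, besselK ν (x * √(1 + v ^ 2)) ^ 2
      = 1 / 2 * ∫ v : ℝ, ∫ p : ℝ, ∫ q : ℝ, Complex.exp (2 * ν * p) *
          (Real.exp (-(2 * x) * √(1 + v ^ 2) * (Real.cosh p * Real.cosh q)) : ℝ) := by
        rw [← integral_const_mul]
        refine integral_congr_ae (ae_of_all _ fun v => ?_)
        simp only [besselK_sq ν (x := x * √(1 + v ^ 2)) (by positivity), neg_mul, mul_assoc]
    _ = 1 / 2 * ∫ p : ℝ, 2 * π / (2 * x : ℝ) * sechKernel (2 * x) (2 * ν) p := by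
        rw [integral_integral_swap hint.integral_prod_left]
        simp only [integral_integral_cexp_mul_exp_neg_mul_sqrt_mul_cosh_mul_cosh (2 * ν)
          (mul_pos two_pos hx)]
    _ = π / (2 * x) * ∫ p : ℝ, sechKernel (2 * x) (2 * ν) p := by
        rw [integral_const_mul]
        push_cast
        ring

theorem stronglyMeasurable_besselK (ν : ℂ) : StronglyMeasurable (besselK ν) := by
  have hcont : Continuous (Function.uncurry (besselKIntegrand ν)) := by
    unfold besselKIntegrand Function.uncurry
    fun_prop
  exact hcont.stronglyMeasurable.integral_prod_right

theorem stronglyMeasurable_besselK_mul_sqrt (ν : ℂ) (x : ℝ) :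
    StronglyMeasurable fun v : ℝ => besselK ν (x * √(1 + v ^ 2)) :=
  (stronglyMeasurable_besselK ν).comp_measurable (by fun_prop)

theorem memLp_two_besselK (ν : ℂ) {x : ℝ} (hx : 0 < x) :
    MemLp (fun v : ℝ => besselK ν (x * √(1 + v ^ 2))) 2 := by
  rw [memLp_two_iff_integrable_sq_norm
    (stronglyMeasurable_besselK_mul_sqrt ν x).aestronglyMeasurable]
  simpa only [norm_pow] using (integrable_besselK_sq ν hx).norm

theorem besselK_neg (ν : ℂ) (x : ℝ) : besselK (-ν) x = besselK ν x := by
  simp only [besselK, besselKIntegrand, neg_mul, Complex.cosh_neg]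

theorem conj_besselK (ν : ℂ) (x : ℝ) :
    starRingEnd ℂ (besselK ν x) = besselK (starRingEnd ℂ ν) x := by
  simp only [besselK, besselKIntegrand, ← integral_conj, map_mul, Complex.conj_ofReal,
    ← Complex.cosh_conj]

theorem ofReal_norm_besselK_sq {ν : ℂ} (hν : ν.re = 0) (x : ℝ) :
    ((‖besselK ν x‖ ^ 2 : ℝ) : ℂ) = besselK ν x ^ 2 := by
  have hconj : starRingEnd ℂ ν = -ν := by
    apply Complex.ext <;> simp [hν]
  rw [Complex.ofReal_pow, ← Complex.mul_conj', conj_besselK, hconj, besselK_neg, sq]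

theorem integral_norm_besselK_sq {ν : ℂ} (hν : ν.re = 0) {x : ℝ} (hx : 0 < x) :
    ∫ v : ℝ, ‖besselK ν (x * √(1 + v ^ 2))‖ ^ 2 =
      π / (2 * x) * ‖∫ p : ℝ, sechKernel (2 * x) (2 * ν) p‖ := by
  have hcomplex := integral_besselK_sq ν hx
  simp only [← ofReal_norm_besselK_sq hν, integral_complex_ofReal] at hcomplex
  have hnorm := congrArg norm hcomplex
  rwa [norm_mul, Complex.norm_of_nonneg (integral_nonneg fun v => sq_nonneg _), norm_div, norm_mul,
    Complex.norm_real, Complex.norm_real, Real.norm_of_nonneg Real.pi_pos.le,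
    Real.norm_of_nonneg hx.le, Complex.norm_ofNat] at hnorm

theorem integral_norm_besselK_sq_le {ν : ℂ} (hν : ν.re = 0) (hν' : 0 ≤ ν.im) {ε x : ℝ}
    (hε : 0 < ε) (hε' : ε ≤ 1 / 2) (hx : 0 < x) :
    ∫ v : ℝ, ‖besselK ν (x * √(1 + v ^ 2))‖ ^ 2 ≤
      8 * π * Real.exp (π * ε * ν.im) * Real.exp (-(π * ν.im)) * Real.log ε⁻¹ / x *
        Real.exp (-(2 * ε * x)) := by
  have hcos : Real.cos (Real.arccos ε) = ε := Real.cos_arccos (by linarith) (by linarith)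
  have hangle : -(2 * ν.im * Real.arccos ε) ≤ π * ε * ν.im - π * ν.im := by
    have h := mul_le_mul_of_nonneg_left (arcsin_le_pi_div_two_mul hε.le (by linarith))
      (show 0 ≤ 2 * ν.im by positivity)
    rw [Real.arccos]
    linarith
  have hshift := norm_integral_sechKernel_le (ν := 2 * ν) (x := 2 * x)
    (by simp [hν]) (by positivity) (Real.arccos_nonneg ε) (Real.arccos_lt_pi_div_two.2 hε)
  have him : (2 * ν).im = 2 * ν.im := by simp
  rw [hcos, him] at hshift
  rw [integral_norm_besselK_sq hν hx]
  calc π / (2 * x) * ‖∫ p : ℝ, sechKernel (2 * x) (2 * ν) p‖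
      ≤ π / (2 * x) * (Real.exp (-(2 * x) * ε - 2 * ν.im * Real.arccos ε) *
          (16 * Real.log ε⁻¹)) := by
        gcongr
        exact hshift.trans (by gcongr; exact integral_inv_sqrt_sinh_sq_add_sq_le hε hε')
    _ ≤ π / (2 * x) * (Real.exp (π * ε * ν.im + -(π * ν.im) + -(2 * ε * x)) *
          (16 * Real.log ε⁻¹)) := by
        have hlog : 0 ≤ Real.log ε⁻¹ := Real.log_nonneg ((one_le_inv₀ hε).2 (by linarith))
        gcongr
        linarith
    _ = _ := by
        rw [Real.exp_add, Real.exp_add]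
        ring

end BesselMeanSquare

section CauchySchwarz

variable {E F : Type*} [NormedAddCommGroup E] [NormedSpace ℝ E] [NormedAddCommGroup F]
  [NormedSpace ℝ F] {f : ℝ → E} {g : ℝ → F} {p u : ℝ}

-- `u ^ ((p - 1) / 2) • f (u ^ p)` is, up to the factor `√|p|`, the isometric action of `v = u ^ p`
-- on `L²(0, ∞)`; for `p = 1 / 2` and `p = -1 / 2` the two weights multiply to `u⁻¹`.
theorem norm_rpow_smul_comp_rpow_sq (f : ℝ → E) (hu : 0 < u) :
    ‖u ^ ((p - 1) / 2) • f (u ^ p)‖ ^ 2 = u ^ (p - 1) * ‖f (u ^ p)‖ ^ 2 := by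
  rw [norm_smul, mul_pow, Real.norm_of_nonneg (by positivity), ← Real.rpow_mul_natCast hu.le,
    Nat.cast_ofNat, div_mul_cancel₀ _ two_ne_zero]

theorem integral_norm_rpow_smul_comp_rpow_sq (f : ℝ → E) (hp : p ≠ 0) :
    ∫ u in Ioi 0, ‖u ^ ((p - 1) / 2) • f (u ^ p)‖ ^ 2 = |p|⁻¹ * ∫ v in Ioi 0, ‖f v‖ ^ 2 := by
  rw [← integral_comp_rpow_Ioi (fun v => ‖f v‖ ^ 2) hp, ← integral_const_mul]
  refine setIntegral_congr_fun measurableSet_Ioi fun u hu => ?_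
  simp only [norm_rpow_smul_comp_rpow_sq f hu, smul_eq_mul, mul_assoc]
  rw [inv_mul_cancel_left₀ (abs_ne_zero.2 hp)]

theorem memLp_two_rpow_smul_comp_rpow (hf : StronglyMeasurable f)
    (hf₂ : MemLp f 2 (volume.restrict (Ioi 0))) (hp : p ≠ 0) :
    MemLp (fun u => u ^ ((p - 1) / 2) • f (u ^ p)) 2 (volume.restrict (Ioi 0)) := by
  have hmeas : StronglyMeasurable fun u => u ^ ((p - 1) / 2) • f (u ^ p) :=
    (by fun_prop : Measurable fun u : ℝ => u ^ ((p - 1) / 2)).stronglyMeasurable.smul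
      (hf.comp_measurable (by fun_prop))
  rw [memLp_two_iff_integrable_sq_norm hmeas.aestronglyMeasurable]
  rw [memLp_two_iff_integrable_sq_norm hf.aestronglyMeasurable] at hf₂
  refine IntegrableOn.congr_fun ((integrableOn_Ioi_comp_rpow_iff' _ hp).2 hf₂) (fun u hu => ?_)
    measurableSet_Ioi
  rw [norm_rpow_smul_comp_rpow_sq f hu, smul_eq_mul]

theorem norm_rpow_smul_comp_rpow_mul_norm (f : ℝ → E) (g : ℝ → F) (hu : 0 < u) :
    ‖u ^ (((1 / 2 : ℝ) - 1) / 2) • f (u ^ (1 / 2 : ℝ))‖ *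
      ‖u ^ ((-(1 / 2 : ℝ) - 1) / 2) • g (u ^ (-(1 / 2) : ℝ))‖ =
      ‖f √u‖ * ‖g (√u)⁻¹‖ / u := by
  have hexp : ((1 / 2 : ℝ) - 1) / 2 + (-(1 / 2 : ℝ) - 1) / 2 = -1 := by norm_num
  rw [norm_smul, norm_smul, mul_mul_mul_comm, Real.norm_of_nonneg (by positivity),
    Real.norm_of_nonneg (by positivity), ← Real.rpow_add hu, hexp, Real.rpow_neg_one,
    Real.rpow_neg hu.le, ← Real.sqrt_eq_rpow, div_eq_inv_mul]

theorem integrableOn_norm_comp_sqrt_mul_norm_comp_inv_sqrt_div (hf : StronglyMeasurable f)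
    (hf₂ : MemLp f 2 (volume.restrict (Ioi 0))) (hg : StronglyMeasurable g)
    (hg₂ : MemLp g 2 (volume.restrict (Ioi 0))) :
    IntegrableOn (fun u => ‖f √u‖ * ‖g (√u)⁻¹‖ / u) (Ioi 0) :=
  IntegrableOn.congr_fun
    ((memLp_two_rpow_smul_comp_rpow hf hf₂ (p := 1 / 2) (by norm_num)).norm.integrable_mul
      (memLp_two_rpow_smul_comp_rpow hg hg₂ (p := -(1 / 2)) (by norm_num)).norm)
    (fun _ hu => norm_rpow_smul_comp_rpow_mul_norm f g hu) measurableSet_Ioi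

theorem integral_norm_comp_sqrt_mul_norm_comp_inv_sqrt_div_le (hf : StronglyMeasurable f)
    (hf₂ : MemLp f 2 (volume.restrict (Ioi 0))) (hg : StronglyMeasurable g)
    (hg₂ : MemLp g 2 (volume.restrict (Ioi 0))) :
    ∫ u in Ioi 0, ‖f √u‖ * ‖g (√u)⁻¹‖ / u ≤
      2 * (√(∫ v in Ioi 0, ‖f v‖ ^ 2) * √(∫ v in Ioi 0, ‖g v‖ ^ 2)) := by
  have hfp := memLp_two_rpow_smul_comp_rpow hf hf₂ (p := 1 / 2) (by norm_num)
  have hgp := memLp_two_rpow_smul_comp_rpow hg hg₂ (p := -(1 / 2)) (by norm_num)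
  have htwo : ENNReal.ofReal 2 = 2 := ENNReal.ofReal_ofNat 2
  have hholder := integral_mul_le_Lp_mul_Lq_of_nonneg Real.HolderConjugate.two_two
    (ae_of_all _ fun u => norm_nonneg _) (ae_of_all _ fun u => norm_nonneg _)
    (htwo ▸ hfp.norm) (htwo ▸ hgp.norm)
  simp only [Real.rpow_two] at hholder
  rw [integral_norm_rpow_smul_comp_rpow_sq f (by norm_num),
    integral_norm_rpow_smul_comp_rpow_sq g (by norm_num), abs_neg, abs_of_pos one_half_pos,
    ← Real.sqrt_eq_rpow, ← Real.sqrt_eq_rpow, inv_div, div_one, Real.sqrt_mul zero_le_two,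
    Real.sqrt_mul zero_le_two, mul_mul_mul_comm, Real.mul_self_sqrt zero_le_two] at hholder
  refine (setIntegral_congr_fun measurableSet_Ioi fun u hu => ?_).trans_le hholder
  exact (norm_rpow_smul_comp_rpow_mul_norm f g hu).symm

end CauchySchwarz

section BesselPairing

variable (ν μ : ℂ) {x₁ x₂ : ℝ}

theorem norm_besselK_mul_norm_besselK_div_eqOn (x₁ x₂ : ℝ) :
    EqOn (fun u => ‖besselK ν (x₁ * √(1 + √u ^ 2))‖ * ‖besselK μ (x₂ * √(1 + (√u)⁻¹ ^ 2))‖ / u)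
      (fun u => ‖besselK ν (x₁ * √(1 + u))‖ * ‖besselK μ (x₂ * √(1 + u⁻¹))‖ / u) (Ioi 0) := by
  intro u hu
  simp only [inv_pow, Real.sq_sqrt (le_of_lt hu)]

theorem integrableOn_norm_besselK_mul_norm_besselK_div (hx₁ : 0 < x₁) (hx₂ : 0 < x₂) :
    IntegrableOn
      (fun u => ‖besselK ν (x₁ * √(1 + u))‖ * ‖besselK μ (x₂ * √(1 + u⁻¹))‖ / u) (Ioi 0) :=
  (integrableOn_norm_comp_sqrt_mul_norm_comp_inv_sqrt_div
    (stronglyMeasurable_besselK_mul_sqrt ν x₁) ((memLp_two_besselK ν hx₁).restrict _)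
    (stronglyMeasurable_besselK_mul_sqrt μ x₂) ((memLp_two_besselK μ hx₂).restrict _)).congr_fun
    (norm_besselK_mul_norm_besselK_div_eqOn ν μ x₁ x₂) measurableSet_Ioi

theorem integral_norm_besselK_sq_eq_two_mul (x : ℝ) :
    ∫ v : ℝ, ‖besselK ν (x * √(1 + v ^ 2))‖ ^ 2 =
      2 * ∫ v in Ioi 0, ‖besselK ν (x * √(1 + v ^ 2))‖ ^ 2 := by
  rw [← integral_comp_abs (f := fun v => ‖besselK ν (x * √(1 + v ^ 2))‖ ^ 2)]
  simp only [sq_abs]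

theorem integral_norm_besselK_mul_norm_besselK_div_le (hx₁ : 0 < x₁) (hx₂ : 0 < x₂) :
    ∫ u in Ioi 0, ‖besselK ν (x₁ * √(1 + u))‖ * ‖besselK μ (x₂ * √(1 + u⁻¹))‖ / u ≤
      √(∫ v : ℝ, ‖besselK ν (x₁ * √(1 + v ^ 2))‖ ^ 2) *
        √(∫ v : ℝ, ‖besselK μ (x₂ * √(1 + v ^ 2))‖ ^ 2) := by
  rw [← setIntegral_congr_fun measurableSet_Ioi
      (norm_besselK_mul_norm_besselK_div_eqOn ν μ x₁ x₂),
    integral_norm_besselK_sq_eq_two_mul, integral_norm_besselK_sq_eq_two_mul,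
    Real.sqrt_mul zero_le_two, Real.sqrt_mul zero_le_two, mul_mul_mul_comm,
    Real.mul_self_sqrt zero_le_two]
  exact integral_norm_comp_sqrt_mul_norm_comp_inv_sqrt_div_le
    (stronglyMeasurable_besselK_mul_sqrt ν x₁) ((memLp_two_besselK ν hx₁).restrict _)
    (stronglyMeasurable_besselK_mul_sqrt μ x₂) ((memLp_two_besselK μ hx₂).restrict _)

end BesselPairing

section Tempered

variable {ν ν₁ ν₂ : ℂ} {ε x₁ x₂ y₁ y₂ : ℝ}

theorem sqrt_div_mul_exp_mul_sqrt_div_mul_exp {D : ℝ} (hD : 0 ≤ D) (hx₁ : 0 ≤ x₁) (a b : ℝ) :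
    √(D / x₁ * Real.exp (-(2 * a))) * √(D / x₂ * Real.exp (-(2 * b))) =
      D / √(x₁ * x₂) * (Real.exp (-a) * Real.exp (-b)) := by
  have hexp (a : ℝ) : √(Real.exp (-(2 * a))) = Real.exp (-a) := by
    rw [Real.sqrt_eq_iff_eq_sq (by positivity) (by positivity), ← Real.exp_nat_mul, Nat.cast_ofNat,
      mul_neg]
  rw [Real.sqrt_mul' _ (Real.exp_nonneg _), Real.sqrt_mul' _ (Real.exp_nonneg _), hexp, hexp,
    mul_mul_mul_comm, Real.sqrt_div hD, Real.sqrt_div hD, div_mul_div_comm, Real.mul_self_sqrt hD,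
    Real.sqrt_mul hx₁]

theorem integral_norm_besselK_mul_norm_besselK_div_le_exp (hν : ν.re = 0) (hν' : 0 ≤ ν.im)
    (hε : 0 < ε) (hε' : ε ≤ 1 / 2) (hx₁ : 0 < x₁) (hx₂ : 0 < x₂) :
    ∫ u in Ioi 0, ‖besselK ν (x₁ * √(1 + u))‖ * ‖besselK ν (x₂ * √(1 + u⁻¹))‖ / u ≤
      8 * π * Real.exp (π * ε * ν.im) * Real.exp (-(π * ν.im)) * Real.log ε⁻¹ / √(x₁ * x₂) *
        (Real.exp (-(ε * x₁)) * Real.exp (-(ε * x₂))) := by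
  have hlog : 0 ≤ Real.log ε⁻¹ := Real.log_nonneg ((one_le_inv₀ hε).2 (by linarith))
  rw [← sqrt_div_mul_exp_mul_sqrt_div_mul_exp (by positivity) hx₁.le, ← mul_assoc, ← mul_assoc]
  refine (integral_norm_besselK_mul_norm_besselK_div_le ν ν hx₁ hx₂).trans ?_
  gcongr
  · exact integral_norm_besselK_sq_le hν hν' hε hε' hx₁
  · exact integral_norm_besselK_sq_le hν hν' hε hε' hx₂

theorem norm_Gamma_one_half_add_sq (hν : ν.re = 0) :
    ‖Complex.Gamma (1 / 2 + ν)‖ ^ 2 = π / Real.cosh (π * ν.im) := by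
  have hν_eq : ν = ν.im * I := by apply Complex.ext <;> simp [hν]
  have hreflect : 1 - (1 / 2 + ν) = starRingEnd ℂ (1 / 2 + ν) := by
    apply Complex.ext <;> simp [hν]
    norm_num
  have hsin : Complex.sin (π * (1 / 2 + ν)) = Real.cosh (π * ν.im) := by
    rw [mul_add, mul_one_div, add_comm, Complex.sin_add_pi_div_two, hν_eq, ← mul_assoc,
      Complex.cos_mul_I, Complex.ofReal_cosh, Complex.ofReal_mul, ← hν_eq]
  have h := Complex.Gamma_mul_Gamma_one_sub (1 / 2 + ν)
  rw [hreflect, Complex.Gamma_conj, Complex.mul_conj', hsin] at h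
  exact_mod_cast h

theorem inv_norm_Gamma_one_half_add_le (hν : ν.re = 0) :
    ‖Complex.Gamma (1 / 2 + ν)‖⁻¹ ≤ (√π)⁻¹ * Real.exp (π * |ν.im| / 2) := by
  refine le_of_sq_le_sq ?_ (by positivity)
  rw [inv_pow, norm_Gamma_one_half_add_sq hν, inv_div, mul_pow, inv_pow,
    Real.sq_sqrt Real.pi_nonneg, ← Real.exp_nat_mul, Nat.cast_ofNat, mul_div_cancel₀ _ two_ne_zero,
    div_eq_inv_mul]
  gcongr
  exact (cosh_le_exp_abs _).trans_eq (by rw [abs_mul, abs_of_pos Real.pi_pos])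

theorem inv_norm_Gamma_mul_inv_norm_Gamma_mul_inv_norm_Gamma_le (hν₁ : ν₁.re = 0)
    (hν₁' : 0 ≤ ν₁.im) (hν₂ : ν₂.re = 0) (hν₂' : 0 ≤ ν₂.im) :
    ‖Complex.Gamma (1 / 2 + (ν₁ + ν₂))‖⁻¹ * ‖Complex.Gamma (1 / 2 + ν₁)‖⁻¹ *
        ‖Complex.Gamma (1 / 2 + ν₂)‖⁻¹ ≤
      (π ^ (3 / 2 : ℝ))⁻¹ * Real.exp (π * (ν₁ + ν₂).im) := by
  have hpi : π ^ (3 / 2 : ℝ) = √π ^ 3 := by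
    rw [Real.sqrt_eq_rpow, ← Real.rpow_mul_natCast Real.pi_nonneg, Nat.cast_ofNat,
      one_div_mul_eq_div]
  calc ‖Complex.Gamma (1 / 2 + (ν₁ + ν₂))‖⁻¹ * ‖Complex.Gamma (1 / 2 + ν₁)‖⁻¹ *
        ‖Complex.Gamma (1 / 2 + ν₂)‖⁻¹
      ≤ (√π)⁻¹ * Real.exp (π * |(ν₁ + ν₂).im| / 2) * ((√π)⁻¹ * Real.exp (π * |ν₁.im| / 2)) *
        ((√π)⁻¹ * Real.exp (π * |ν₂.im| / 2)) := by
        gcongr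
        · exact inv_norm_Gamma_one_half_add_le (by rw [Complex.add_re, hν₁, hν₂, add_zero])
        · exact inv_norm_Gamma_one_half_add_le hν₁
        · exact inv_norm_Gamma_one_half_add_le hν₂
    _ = (π ^ (3 / 2 : ℝ))⁻¹ * (Real.exp (π * (ν₁.im + ν₂.im) / 2) * Real.exp (π * ν₁.im / 2) *
        Real.exp (π * ν₂.im / 2)) := by
        rw [hpi, Complex.add_im, abs_of_nonneg (add_nonneg hν₁' hν₂'), abs_of_nonneg hν₁',
          abs_of_nonneg hν₂']
        ring
    _ = (π ^ (3 / 2 : ℝ))⁻¹ * Real.exp (π * (ν₁ + ν₂).im) := by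
        rw [← Real.exp_add, ← Real.exp_add, Complex.add_im]
        ring_nf

theorem norm_whittakerIntegrand (hν : ν₁.re = ν₂.re) (y₁ y₂ : ℝ) {u : ℝ} (hu : 0 < u) :
    ‖whittakerIntegrand ν₁ ν₂ y₁ y₂ u‖ =
      ‖besselK (3 / 2 * (ν₁ + ν₂)) (2 * π * y₁ * √(1 + u))‖ *
        ‖besselK (3 / 2 * (ν₁ + ν₂)) (2 * π * y₂ * √(1 + u⁻¹))‖ / u := by
  have hre : (3 / 4 * (ν₁ - ν₂)).re = 0 := by simp [hν]
  rw [whittakerIntegrand, norm_div, norm_mul, norm_mul, Complex.norm_cpow_eq_rpow_re_of_pos hu,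
    hre, Real.rpow_zero, mul_one, Complex.norm_of_nonneg hu.le]

theorem stronglyMeasurable_whittakerIntegrand (ν₁ ν₂ : ℂ) (y₁ y₂ : ℝ) :
    StronglyMeasurable (whittakerIntegrand ν₁ ν₂ y₁ y₂) := by
  have hK (f : ℝ → ℝ) (hf : Measurable f) :
      Measurable fun u => besselK (3 / 2 * (ν₁ + ν₂)) (f u) :=
    (stronglyMeasurable_besselK _).measurable.comp hf
  have hcpow : Measurable fun u : ℝ => (u : ℂ) ^ (3 / 4 * (ν₁ - ν₂)) := by fun_prop
  exact ((((hK _ (by fun_prop)).mul (hK _ (by fun_prop))).mul hcpow).div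
    Complex.measurable_ofReal).stronglyMeasurable

theorem integrableOn_whittakerIntegrand (hν : ν₁.re = ν₂.re) (hy₁ : 0 < y₁) (hy₂ : 0 < y₂) :
    IntegrableOn (whittakerIntegrand ν₁ ν₂ y₁ y₂) (Ioi 0) := by
  refine (integrable_norm_iff
    (stronglyMeasurable_whittakerIntegrand ν₁ ν₂ y₁ y₂).aestronglyMeasurable).1 ?_
  exact (integrableOn_norm_besselK_mul_norm_besselK_div _ _ (by positivity)
    (by positivity)).congr_fun (fun u hu => (norm_whittakerIntegrand hν y₁ y₂ hu).symm)
    measurableSet_Ioi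

theorem norm_normalizedWhittaker (hν : ν₁.re = ν₂.re) (hy₁ : 0 < y₁) (hy₂ : 0 < y₂) :
    ‖normalizedWhittaker ν₁ ν₂ y₁ y₂‖ =
      4 * π ^ (3 / 2 : ℝ) *
        (‖Complex.Gamma (1 / 2 + 3 / 2 * (ν₁ + ν₂))‖⁻¹ * ‖Complex.Gamma (1 / 2 + 3 / 2 * ν₁)‖⁻¹ *
          ‖Complex.Gamma (1 / 2 + 3 / 2 * ν₂)‖⁻¹) *
        (y₁ * y₂) * ‖∫ u in Ioi 0, whittakerIntegrand ν₁ ν₂ y₁ y₂ u‖ := by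
  have hre : ((ν₁ - ν₂) / 2).re = 0 := by simp [hν]
  rw [normalizedWhittaker, norm_mul, norm_mul, Complex.norm_of_nonneg (by positivity),
    Complex.norm_cpow_eq_rpow_re_of_pos (by positivity), hre, Real.rpow_zero, mul_one]

theorem norm_integral_whittakerIntegrand_le (hν₁ : ν₁.re = 0) (hν₁' : 0 ≤ ν₁.im)
    (hν₂ : ν₂.re = 0) (hν₂' : 0 ≤ ν₂.im) (hε : 0 < ε) (hε' : ε ≤ 1 / 2) (hy₁ : 0 < y₁)
    (hy₂ : 0 < y₂) :
    ‖∫ u in Ioi 0, whittakerIntegrand ν₁ ν₂ y₁ y₂ u‖ ≤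
      4 * Real.exp (3 / 2 * π * (ε * (ν₁ + ν₂).im)) * Real.exp (-(3 / 2 * π * (ν₁ + ν₂).im)) *
        Real.log ε⁻¹ / √(y₁ * y₂) *
        (Real.exp (-(2 * π * ε * y₁)) * Real.exp (-(2 * π * ε * y₂))) := by
  have him : (3 / 2 * (ν₁ + ν₂)).im = 3 / 2 * (ν₁ + ν₂).im := by simp
  have hsqrt : √(2 * π * y₁ * (2 * π * y₂)) = 2 * π * √(y₁ * y₂) := by
    rw [mul_mul_mul_comm, Real.sqrt_mul (by positivity), Real.sqrt_mul_self (by positivity)]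
  calc ‖∫ u in Ioi 0, whittakerIntegrand ν₁ ν₂ y₁ y₂ u‖
      ≤ ∫ u in Ioi 0, ‖besselK (3 / 2 * (ν₁ + ν₂)) (2 * π * y₁ * √(1 + u))‖ *
          ‖besselK (3 / 2 * (ν₁ + ν₂)) (2 * π * y₂ * √(1 + u⁻¹))‖ / u :=
        (norm_integral_le_integral_norm _).trans_eq
          (setIntegral_congr_fun measurableSet_Ioi fun _ hu =>
            norm_whittakerIntegrand (hν₁.trans hν₂.symm) y₁ y₂ hu)
    _ ≤ _ := integral_norm_besselK_mul_norm_besselK_div_le_exp (by simp [hν₁, hν₂])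
        (by simpa using add_nonneg hν₁' hν₂') hε hε' (by positivity) (by positivity)
    _ = _ := by
        rw [him, hsqrt]
        field_simp
        ring_nf

theorem norm_normalizedWhittaker_le_exp_mul (hν₁ : ν₁.re = 0) (hν₁' : 0 ≤ ν₁.im) (hν₂ : ν₂.re = 0)
    (hν₂' : 0 ≤ ν₂.im) (hε : 0 < ε) (hε' : ε ≤ 1 / 2) (hy₁ : 0 < y₁) (hy₂ : 0 < y₂) :
    ‖normalizedWhittaker ν₁ ν₂ y₁ y₂‖ ≤
      16 * Real.exp (3 / 2 * π * (ε * (ν₁ + ν₂).im)) * Real.log ε⁻¹ * √(y₁ * y₂) *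
        (Real.exp (-(2 * π * ε * y₁)) * Real.exp (-(2 * π * ε * y₂))) := by
  have hGamma := inv_norm_Gamma_mul_inv_norm_Gamma_mul_inv_norm_Gamma_le
    (ν₁ := 3 / 2 * ν₁) (ν₂ := 3 / 2 * ν₂) (by simp [hν₁]) (by simpa using hν₁') (by simp [hν₂])
    (by simpa using hν₂')
  have him : π * (3 / 2 * (ν₁ + ν₂)).im = 3 / 2 * π * (ν₁ + ν₂).im := by
    have hscale : (3 / 2 * (ν₁ + ν₂)).im = 3 / 2 * (ν₁ + ν₂).im := by simp
    rw [hscale]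
    ring
  rw [← mul_add, him] at hGamma
  have hcancel : Real.exp (3 / 2 * π * (ν₁ + ν₂).im) *
      Real.exp (-(3 / 2 * π * (ν₁ + ν₂).im)) = 1 := by
    rw [← Real.exp_add, add_neg_cancel, Real.exp_zero]
  have hdiv : y₁ * y₂ / √(y₁ * y₂) = √(y₁ * y₂) := Real.div_sqrt
  set r := 3 / 2 * π * (ν₁ + ν₂).im
  set D := 4 * Real.exp (3 / 2 * π * (ε * (ν₁ + ν₂).im)) * Real.log ε⁻¹
  set decay := Real.exp (-(2 * π * ε * y₁)) * Real.exp (-(2 * π * ε * y₂))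
  calc ‖normalizedWhittaker ν₁ ν₂ y₁ y₂‖
      ≤ 4 * π ^ (3 / 2 : ℝ) * ((π ^ (3 / 2 : ℝ))⁻¹ * Real.exp r) * (y₁ * y₂) *
        (4 * Real.exp (3 / 2 * π * (ε * (ν₁ + ν₂).im)) * Real.exp (-r) * Real.log ε⁻¹ /
          √(y₁ * y₂) * decay) := by
        rw [norm_normalizedWhittaker (hν₁.trans hν₂.symm) hy₁ hy₂]
        gcongr
        exact norm_integral_whittakerIntegrand_le hν₁ hν₁' hν₂ hν₂' hε hε' hy₁ hy₂
    _ = 4 * D * (y₁ * y₂ / √(y₁ * y₂)) * decay * (π ^ (3 / 2 : ℝ) * (π ^ (3 / 2 : ℝ))⁻¹) *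
        (Real.exp r * Real.exp (-r)) := by ring
    _ = _ := by
        rw [hdiv, hcancel, mul_inv_cancel₀ (by positivity)]
        ring

end Tempered

namespace IsTemperedSpectralParameter

variable {ν₀ ν₁ ν₂ : ℂ} {y₁ y₂ A : ℝ}

theorem spectralSize_eq (h : IsTemperedSpectralParameter ν₀ ν₁ ν₂) :
    spectralSize ν₀ ν₁ ν₂ = max 2 (ν₁.im + ν₂.im) := by
  rw [spectralSize, ← Complex.abs_im_eq_norm.2 h.re_zero, ← Complex.abs_im_eq_norm.2 h.re_one,
    ← Complex.abs_im_eq_norm.2 h.re_two, abs_of_nonneg h.im_zero_nonneg,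
    abs_of_nonneg h.im_one_nonneg, abs_of_nonneg h.im_two_nonneg, h.sum_eq, Complex.add_im,
    max_eq_left (max_le (le_add_of_nonneg_right h.im_two_nonneg)
      (le_add_of_nonneg_left h.im_one_nonneg))]

theorem laplaceEigenvalue_eq_ofReal (h : IsTemperedSpectralParameter ν₀ ν₁ ν₂) :
    laplaceEigenvalue ν₁ ν₂ =
      ((1 + 3 * (ν₁.im ^ 2 + ν₁.im * ν₂.im + ν₂.im ^ 2) : ℝ) : ℂ) := by
  have hν₁ : ν₁ = ν₁.im * I := by apply Complex.ext <;> simp [h.re_one]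
  have hν₂ : ν₂ = ν₂.im * I := by apply Complex.ext <;> simp [h.re_two]
  rw [laplaceEigenvalue, hν₁, hν₂]
  simp only [Complex.mul_I_im, Complex.ofReal_re]
  push_cast
  linear_combination (-3 * (ν₁.im ^ 2 + ν₁.im * ν₂.im + ν₂.im ^ 2) : ℂ) * Complex.I_sq

theorem laplaceEigenvalue_re_pos (h : IsTemperedSpectralParameter ν₀ ν₁ ν₂) :
    0 < (laplaceEigenvalue ν₁ ν₂).re := by
  have hprod := mul_nonneg h.im_one_nonneg h.im_two_nonneg
  rw [h.laplaceEigenvalue_eq_ofReal, Complex.ofReal_re]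
  positivity

theorem ofReal_laplaceEigenvalue_re (h : IsTemperedSpectralParameter ν₀ ν₁ ν₂) :
    ((laplaceEigenvalue ν₁ ν₂).re : ℂ) = laplaceEigenvalue ν₁ ν₂ := by
  rw [h.laplaceEigenvalue_eq_ofReal, Complex.ofReal_re]

theorem half_mul_sqrt_laplaceEigenvalue_le (h : IsTemperedSpectralParameter ν₀ ν₁ ν₂) :
    1 / 2 * √(laplaceEigenvalue ν₁ ν₂).re ≤ spectralSize ν₀ ν₁ ν₂ := by
  rw [one_div_mul_eq_div, div_le_iff₀' two_pos, h.spectralSize_eq, h.laplaceEigenvalue_eq_ofReal,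
    Complex.ofReal_re]
  refine Real.sqrt_le_iff.2 ⟨by positivity, ?_⟩
  have hprod := mul_nonneg h.im_one_nonneg h.im_two_nonneg
  have htwo : (2 : ℝ) ^ 2 ≤ max 2 (ν₁.im + ν₂.im) ^ 2 := by gcongr; exact le_max_left _ _
  have hsum : (ν₁.im + ν₂.im) ^ 2 ≤ max 2 (ν₁.im + ν₂.im) ^ 2 :=
    pow_le_pow_left₀ (add_nonneg h.im_one_nonneg h.im_two_nonneg) (le_max_right _ _) 2
  linarith

theorem spectralSize_le_two_mul_sqrt (h : IsTemperedSpectralParameter ν₀ ν₁ ν₂) :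
    spectralSize ν₀ ν₁ ν₂ ≤ 2 * √(laplaceEigenvalue ν₁ ν₂).re := by
  have hprod := mul_nonneg h.im_one_nonneg h.im_two_nonneg
  rw [← div_le_iff₀' two_pos, h.spectralSize_eq, h.laplaceEigenvalue_eq_ofReal, Complex.ofReal_re]
  refine Real.le_sqrt_of_sq_le ?_
  rcases max_cases 2 (ν₁.im + ν₂.im) with ⟨hmax, -⟩ | ⟨hmax, -⟩ <;> rw [hmax] <;>
    linarith [sq_nonneg ν₁.im, sq_nonneg ν₂.im]

theorem norm_normalizedWhittaker_le_exp (h : IsTemperedSpectralParameter ν₀ ν₁ ν₂) (hy₁ : 0 < y₁)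
    (hy₂ : 0 < y₂) :
    ‖normalizedWhittaker ν₁ ν₂ y₁ y₂‖ ≤
      16 * Real.exp (3 / 2 * π) * Real.log (spectralSize ν₀ ν₁ ν₂) * √(y₁ * y₂) *
        (Real.exp (-(y₁ / spectralSize ν₀ ν₁ ν₂)) *
          Real.exp (-(y₂ / spectralSize ν₀ ν₁ ν₂))) := by
  have hT : 2 ≤ spectralSize ν₀ ν₁ ν₂ := le_max_left _ _
  have hνT : (ν₁ + ν₂).im ≤ spectralSize ν₀ ν₁ ν₂ := h.spectralSize_eq ▸ le_max_right _ _
  set T := spectralSize ν₀ ν₁ ν₂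
  have hlog : 0 ≤ Real.log T := Real.log_nonneg (by linarith)
  have hangle : 3 / 2 * π * (T⁻¹ * (ν₁ + ν₂).im) ≤ 3 / 2 * π :=
    mul_le_of_le_one_right (by positivity)
      (by rwa [inv_mul_le_iff₀ (by positivity), mul_one])
  have hdecay {y : ℝ} (hy : 0 < y) : y / T ≤ 2 * π * T⁻¹ * y := by
    rw [mul_assoc, ← div_eq_inv_mul]
    exact le_mul_of_one_le_left (by positivity) (by linarith [Real.pi_gt_three])
  refine (norm_normalizedWhittaker_le_exp_mul h.re_one h.im_one_nonneg h.re_two h.im_two_nonneg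
    (inv_pos.2 (by positivity)) (one_div (2 : ℝ) ▸ inv_anti₀ two_pos hT) hy₁ hy₂).trans ?_
  rw [inv_inv]
  gcongr
  · exact hdecay hy₁
  · exact hdecay hy₂

theorem norm_normalizedWhittaker_le_rpow (h : IsTemperedSpectralParameter ν₀ ν₁ ν₂) (hA : 0 ≤ A)
    (hy₁ : 0 < y₁) (hy₂ : 0 < y₂) :
    ‖normalizedWhittaker ν₁ ν₂ y₁ y₂‖ ≤
      16 * Real.exp (3 / 2 * π) * ((A + 1) ^ A) ^ 2 * Real.log (spectralSize ν₀ ν₁ ν₂) *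
        √(y₁ * y₂) * (1 + y₁ / spectralSize ν₀ ν₁ ν₂) ^ (-A) *
        (1 + y₂ / spectralSize ν₀ ν₁ ν₂) ^ (-A) := by
  have hT : 2 ≤ spectralSize ν₀ ν₁ ν₂ := le_max_left _ _
  set T := spectralSize ν₀ ν₁ ν₂
  have hlog : 0 ≤ Real.log T := Real.log_nonneg (by linarith)
  calc ‖normalizedWhittaker ν₁ ν₂ y₁ y₂‖
      ≤ 16 * Real.exp (3 / 2 * π) * Real.log T * √(y₁ * y₂) *
          (Real.exp (-(y₁ / T)) * Real.exp (-(y₂ / T))) :=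
        h.norm_normalizedWhittaker_le_exp hy₁ hy₂
    _ ≤ 16 * Real.exp (3 / 2 * π) * Real.log T * √(y₁ * y₂) *
          ((A + 1) ^ A * (1 + y₁ / T) ^ (-A) * ((A + 1) ^ A * (1 + y₂ / T) ^ (-A))) := by
        gcongr <;> exact exp_neg_le_rpow_mul_one_add_rpow_neg hA (by positivity)
    _ = _ := by ring

end IsTemperedSpectralParameter

end

theorem mainTheorem4 :
    (∃ c C : ℝ, 0 < c ∧ 0 < C ∧ ∀ ν₀ ν₁ ν₂ : ℂ, IsTemperedSpectralParameter ν₀ ν₁ ν₂ →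
      ∃ lam : ℝ, 0 < lam ∧ (lam : ℂ) = laplaceEigenvalue ν₁ ν₂ ∧
        c * √lam ≤ spectralSize ν₀ ν₁ ν₂ ∧ spectralSize ν₀ ν₁ ν₂ ≤ C * √lam) ∧
    (∀ A : ℝ, 0 < A → ∃ C : ℝ, 0 < C ∧
      ∀ ν₀ ν₁ ν₂ : ℂ, IsTemperedSpectralParameter ν₀ ν₁ ν₂ →
      ∀ y₁ y₂ : ℝ, 0 < y₁ → 0 < y₂ →
        IntegrableOn (whittakerIntegrand ν₁ ν₂ y₁ y₂) (Set.Ioi 0) ∧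
        ‖normalizedWhittaker ν₁ ν₂ y₁ y₂‖ ≤
          C * Real.log (spectralSize ν₀ ν₁ ν₂) * √(y₁ * y₂) *
            (1 + y₁ / spectralSize ν₀ ν₁ ν₂) ^ (-A) *
            (1 + y₂ / spectralSize ν₀ ν₁ ν₂) ^ (-A)) := by
  refine ⟨⟨1 / 2, 2, one_half_pos, two_pos, fun ν₀ ν₁ ν₂ h => ?_⟩, fun A hA => ?_⟩
  · exact ⟨(laplaceEigenvalue ν₁ ν₂).re, h.laplaceEigenvalue_re_pos, h.ofReal_laplaceEigenvalue_re,
      h.half_mul_sqrt_laplaceEigenvalue_le, h.spectralSize_le_two_mul_sqrt⟩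
  · exact ⟨16 * Real.exp (3 / 2 * Real.pi) * ((A + 1) ^ A) ^ 2, by positivity,
      fun ν₀ ν₁ ν₂ h y₁ y₂ hy₁ hy₂ =>
        ⟨integrableOn_whittakerIntegrand (h.re_one.trans h.re_two.symm) hy₁ hy₂,
          h.norm_normalizedWhittaker_le_rpow hA.le hy₁ hy₂⟩⟩
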